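/- **Proposition 2.8.** Let $\mathcal A$ be an abelian category with enough injectives. Complexes are cochain complexes indexed by $\mathbb Z$. Let $C(\mathcal A)$ be the category of complexes with entries in $\mathcal A$, let $C^{[0}(\mathcal A)$ be its full subcategory of complexes $X$ with $X^i=0$ for $i<0$, and let $K^{[0}(\mathcal A)$ be the full subcategory of the homotopy category $K(\mathcal A)$ on these complexes. A double complex $X$ has entries $X^{i,j}$ ($i,j\in\mathbb Z$) and commuting differentials $\partial:X^{i,j}\to X^{i+1,j}$ and $d:X^{i,j}\to X^{i,j+1}$ with $\partial\partial=0$ and $dd=0$; its rows are the complexes $X^{i,*}$ and its columns the complexes $X^{*,j}$. It is *horizontally split acyclic* if it is isomorphic to a direct sum over $j\in\mathbb Z$ of double complexes consisting of two equal columns $T_j=T_j$, connected by identities, in columns $j$ and $j+1$, and zero elsewhere; *vertically split acyclic* is defined likewise with rows in place of columns. It is *split acyclic* if it is isomorphic to the direct sum of a horizontally and a vertically split acyclic double complex. Let $KK(\mathcal A)$ be the category with double complexes as objects and with morphisms the morphisms of double complexes modulo those that factor over a split acyclic double complex. A short exact sequence in $C(\mathcal A)$ is *pure* if all connecting morphisms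 in its long exact homology sequence vanish. A morphism in $C(\mathcal A)$ is a *pure monomorphism* (*pure epimorphism*) if it is the first (second) morphism of a pure short exact sequence, and *pure* if it is a pure epimorphism followed by a pure monomorphism. A complex $I$ is *relatively injective* if $\mathrm{Hom}(-,I)$ maps pure short exact sequences to short exact sequences. A *Cartan–Eilenberg resolution* of $X\in C(\mathcal A)$ is a double complex $J$, regarded as the complex $(J^{i,*})_{i\in\mathbb Z}$ with entries in $C(\mathcal A)$, with $J^{i,*}=0$ for $i<0$, with all $J^{i,*}$ relatively injective and all differentials $J^{i,*}\to J^{i+1,*}$ pure, together with a quasi-isomorphism to $J$ from $X$ placed in degree $i=0$ which consists of pure monomorphisms. Let $CC^{\llcorner,\mathrm{CE}}(\mathrm{Inj}\,\mathcal A)$ be the full subcategory of the category of double complexes, and $KK^{\llcorner,\mathrm{CE}}(\mathrm{Inj}\,\mathcal A)$ the full subcategory of $KK(\mathcal A)$, consisting of those $J$ with $J^{i,j}=0$ whenever $i<0$ or $j<0$ that are Cartan–Eilenberg resolutions of some complex. For a double complex $J$ let $H^0(J^{*,-})$ be the complex with entry $H^0(J^{*,j})$ (cohomology of the $j$-th column)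 at position $j$. Then the functor $H^0((-)^{*,-}) : CC^{\llcorner,\mathrm{CE}}(\mathrm{Inj}\,\mathcal A)\to C^{[0}(\mathcal A)$ induces, via the residue class functors, an equivalence of categories $$KK^{\llcorner,\mathrm{CE}}(\mathrm{Inj}\,\mathcal A)\;\xrightarrow{\ \sim\ }\;K^{[0}(\mathcal A).$$ -/

import Mathlib

open CategoryTheory CategoryTheory.Limits

universe v u

namespace CERes

section Additive

variable {C : Type u} [Category.{v} C] [Preadditive C]

/-- Two parallel morphisms are identified in the quotient `C / M` by a full additive subcategory `M`
(given by the property `P` of belonging to `M`) if their difference factors over an object of `M`. -/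
def factorsRel (P : ObjectProperty C) : HomRel C :=
  fun X Y f g => ∃ (S : C) (_ : P S) (a : X ⟶ S) (b : S ⟶ Y), f - g = a ≫ b

variable [HasBinaryBiproducts C]

/-- The complex with entry `T i ⊞ T (i + 1)` at position `i`, whose differential maps the summand
`T (i + 1)` at position `i` identically to the summand `T (i + 1)` at position `i + 1`, and is zero
on the summand `T i`.  It is the direct sum of the complexes
`⋯ ⟶ 0 ⟶ T (i + 1) = T (i + 1) ⟶ 0 ⟶ ⋯` (positions `i`, `i + 1`). -/
noncomputable def splitAcyclicComplex (T : ℤ → C) : CochainComplex C ℤ :=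
  CochainComplex.of (fun i => T i ⊞ T (i + 1)) (fun _ => biprod.snd ≫ biprod.inl) (by simp)

end Additive

section Abelian

variable (A : Type u) [Category.{v} A] [Abelian A]

/-- Double complexes, with entries `(X.X i).X j`: the outer index `i` counts the rows `X.X i`,
the outer differential is the vertical one, the differentials of the rows are the horizontal ones. -/
abbrev DoubleComplex := HomologicalComplex₂ A (ComplexShape.up ℤ) (ComplexShape.up ℤ)

variable {A}

/-- Vertically split acyclic double complexes; `T i` is a complex, to be placed as a row. -/
def IsVerticallySplitAcyclic (X : DoubleComplex A) : Prop :=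
  ∃ T : ℤ → CochainComplex A ℤ, Nonempty (X ≅ splitAcyclicComplex T)

/-- Horizontally split acyclic double complexes; `T j` is a complex, to be placed as a column. -/
def IsHorizontallySplitAcyclic (X : DoubleComplex A) : Prop :=
  ∃ T : ℤ → CochainComplex A ℤ,
    Nonempty (X ≅ HomologicalComplex₂.flip (splitAcyclicComplex T))

variable (A)

/-- A double complex is split acyclic if it is isomorphic to the direct sum of a horizontally and a
vertically split acyclic double complex. -/
def isSplitAcyclic : ObjectProperty (DoubleComplex A) := fun X =>
  ∃ H V : DoubleComplex A, IsHorizontallySplitAcyclic H ∧ IsVerticallySplitAcyclic V ∧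
    Nonempty (X ≅ H ⊞ V)

/-- The quotient of the category of double complexes by the full subcategory of split acyclic double
complexes. -/
abbrev DoubleHomotopyCategory := Quotient (factorsRel (isSplitAcyclic A))

/-- `X` is zero outside the first quadrant. -/
def isFirstQuadrant : ObjectProperty (DoubleComplex A) := fun X =>
  ∀ i j : ℤ, (i < 0 ∨ j < 0) → IsZero ((X.X i).X j)

/-- The full subcategory of complexes `X` with `X.X i = 0` for `i < 0`. -/
abbrev ComplexGEZero :=
  ObjectProperty.FullSubcategory (fun X : CochainComplex A ℤ => X.IsStrictlyGE 0)

/-- The homotopy category of complexes `X` with `X.X i = 0` for `i < 0`, a full subcategory of the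
homotopy category of all complexes. -/
abbrev HomotopyGEZero :=
  ObjectProperty.FullSubcategory
    (fun X : HomotopyCategory A (ComplexShape.up ℤ) => CochainComplex.IsStrictlyGE X.as 0)

/-- The residue class functor from complexes to the homotopy category, restricted to complexes in
degrees `≥ 0`. -/
def complexQuotient : ComplexGEZero A ⥤ HomotopyGEZero A :=
  ObjectProperty.lift _
    (ObjectProperty.ι _ ⋙ HomotopyCategory.quotient A (ComplexShape.up ℤ)) (fun X => X.property)

variable {A}

/-- The pure short exact sequences of complexes: short exact sequences all of whose connecting
morphisms on homology vanish. -/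
def IsPureShortExact (S : ShortComplex (CochainComplex A ℤ)) : Prop :=
  ∃ hS : S.ShortExact, ∀ (i j : ℤ) (hij : (ComplexShape.up ℤ).Rel i j), hS.δ i j hij = 0

/-- Pure monomorphisms: the first morphisms of pure short exact sequences. -/
def IsPureMono {X Y : CochainComplex A ℤ} (f : X ⟶ Y) : Prop :=
  ∃ (Z : CochainComplex A ℤ) (g : Y ⟶ Z) (w : f ≫ g = 0),
    IsPureShortExact (ShortComplex.mk f g w)

/-- Pure epimorphisms: the second morphisms of pure short exact sequences. -/
def IsPureEpi {Y Z : CochainComplex A ℤ} (g : Y ⟶ Z) : Prop :=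
  ∃ (X : CochainComplex A ℤ) (f : X ⟶ Y) (w : f ≫ g = 0),
    IsPureShortExact (ShortComplex.mk f g w)

/-- Pure morphisms: composites of a pure epimorphism followed by a pure monomorphism. -/
def IsPure {X Y : CochainComplex A ℤ} (d : X ⟶ Y) : Prop :=
  ∃ (Z : CochainComplex A ℤ) (p : X ⟶ Z) (i : Z ⟶ Y), IsPureEpi p ∧ IsPureMono i ∧ p ≫ i = d

/-- `I` is relatively injective if `Hom(-, I)` maps pure short exact sequences to short exact
sequences; as `Hom(-, I)` is left exact, this says that morphisms to `I` extend along pure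
monomorphisms. -/
def IsRelativelyInjective (I : CochainComplex A ℤ) : Prop :=
  ∀ ⦃X Y : CochainComplex A ℤ⦄ (f : X ⟶ Y), IsPureMono f → ∀ g : X ⟶ I, ∃ h : Y ⟶ I, f ≫ h = g

/-- `ε` exhibits `J` as a Cartan-Eilenberg resolution of the complex `X`, i.e. as a relatively
injective resolution of the object `X` of the exact category of complexes: `J` is a complex of
complexes in degrees `≥ 0` with relatively injective entries and pure differentials, and `ε` is a
quasi-isomorphism from `X`, viewed as a complex concentrated in degree `0`, to `J`, consisting of
pure monomorphisms.  Homology is taken in the abelian category of complexes; since all differentials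
are pure, it agrees with homology in the exact category. -/
structure IsCartanEilenbergResolution (X : CochainComplex A ℤ) (J : DoubleComplex A)
    (ε : (HomologicalComplex.single (CochainComplex A ℤ) (ComplexShape.up ℤ) 0).obj X ⟶ J) :
    Prop where
  zero_of_neg : ∀ k : ℤ, k < 0 → IsZero (J.X k)
  injective : ∀ k : ℤ, IsRelativelyInjective (J.X k)
  pure_d : ∀ k : ℤ, IsPure (J.d k (k + 1))
  quasiIso : QuasiIso ε
  pureMono : ∀ k : ℤ, IsPureMono (ε.f k)

variable (A)

/-- First quadrant double complexes that are Cartan-Eilenberg resolutions of some complex. -/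
def isCE : ObjectProperty (DoubleComplex A) := fun J =>
  isFirstQuadrant A J ∧ ∃ (X : CochainComplex A ℤ)
    (ε : (HomologicalComplex.single (CochainComplex A ℤ) (ComplexShape.up ℤ) 0).obj X ⟶ J),
      IsCartanEilenbergResolution X J ε

/-- The category of Cartan-Eilenberg resolutions, a full subcategory of the category of (first
quadrant) double complexes. -/
abbrev CECategory := (isCE A).FullSubcategory

/-- The homotopy category of Cartan-Eilenberg resolutions, a full subcategory of the quotient of the
category of all double complexes by the split acyclic ones. -/
abbrev CEHomotopyCategory :=
  ObjectProperty.FullSubcategory (fun X : DoubleHomotopyCategory A => isCE A X.as)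

/-- The residue class functor from Cartan-Eilenberg resolutions to their homotopy category. -/
def ceQuotient : CECategory A ⥤ CEHomotopyCategory A :=
  ObjectProperty.lift _ ((isCE A).ι ⋙ Quotient.functor _) (fun X => X.property)

/-- Columnwise `H^0`: it sends a double complex `X` to the complex with entry `H^0` of the `j`-th
column of `X` at position `j`. -/
noncomputable def columnwiseHZero : DoubleComplex A ⥤ CochainComplex A ℤ :=
  HomologicalComplex₂.flipFunctor A (ComplexShape.up ℤ) (ComplexShape.up ℤ) ⋙
    (HomologicalComplex.homologyFunctor A (ComplexShape.up ℤ) 0).mapHomologicalComplex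
      (ComplexShape.up ℤ)

variable {A}

theorem columnwiseHZero_isStrictlyGE (X : DoubleComplex A) (hX : isFirstQuadrant A X) :
    ((columnwiseHZero A).obj X).IsStrictlyGE 0 := by
  rw [CochainComplex.isStrictlyGE_iff]
  intro j hj
  exact ShortComplex.isZero_homology_of_isZero_X₂ _ (hX 0 j (Or.inr hj))

variable (A)

/-- Columnwise `H^0` as a functor from Cartan-Eilenberg resolutions to complexes in degrees
`≥ 0`. -/
noncomputable def ceHZero : CECategory A ⥤ ComplexGEZero A :=
  ObjectProperty.lift _ ((isCE A).ι ⋙ columnwiseHZero A)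
    (fun X => columnwiseHZero_isStrictlyGE X.obj X.property.1)

end Abelian

end CERes

/-! ### Comparison lemmas for Hom-exact resolutions -/

namespace CERes

section Comparison

/-! A Cartan–Eilenberg resolution is a relatively injective resolution in the exact category of
complexes with pure short exact sequences, and columnwise `H^0` recovers the resolved complex as the
kernel of `J.d 0 1`.

The functor on homotopy categories exists because it kills split acyclic objects: `H^0` turns a
horizontally split acyclic double complex into a contractible complex, and a vertically split
acyclic one, whose columns are contractible, into zero.

Fullness is the comparison theorem for relatively injective resolutions
(`IsCartanEilenbergResolution.isHomExact`, `exists_lift_of_isHomExact`), and holds even before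
passing to residue classes.

Faithfulness (`exists_factorization_of_homotopy`) uses two kinds of homotopy. Suppose `χ` induces a
null-homotopic morphism on `H^0`. The columns are injective resolutions in `A`, so each component of
the homotopy lifts to a morphism of columns; these lifts yield a horizontally null-homotopic `N`
that agrees with `χ` on `H^0`. Then `χ - N` vanishes on `H^0`, hence is vertically null-homotopic.
Null-homotopic morphisms factor over split acyclic complexes, so `χ` factors over a horizontally
plus a vertically split acyclic double complex.

Density needs enough relative injectives among complexes in degrees `≥ 0`
(`exists_pureMono_relativelyInjective`); iterated pure embeddings are spliced to a resolution. -/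

theorem exists_seq_of_forall_exists {α : ℕ → Type*} (R : ∀ n, α n → α (n + 1) → Prop)
    (P : ∀ n, α n → Prop) (a : α 0) (ha : P 0 a)
    (hP : ∀ n x, P n x → ∃ y, R n x y ∧ P (n + 1) y) :
    ∃ s : ∀ n, α n, s 0 = a ∧ ∀ n, R n (s n) (s (n + 1)) := by
  choose next hR hN using hP
  let t : ∀ n, { x : α n // P n x } := fun n =>
    Nat.rec ⟨a, ha⟩ (fun n x => ⟨next n x.1 x.2, hN n x.1 x.2⟩) n
  exact ⟨fun n => (t n).1, rfl, fun n => hR n (t n).1 (t n).2⟩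

variable {E : Type u} [Category.{v} E] [Preadditive E]

/-- The functor `Hom(-, M)` maps the augmented complex `0 ⟶ X ⟶ J.X 0 ⟶ J.X 1 ⟶ ⋯` to an exact
complex, except possibly for the injectivity at the start. -/
structure IsHomExact {X : E} (J : CochainComplex E ℤ) (ι : X ⟶ J.X 0) (M : E) : Prop where
  exists_extension : ∀ g : X ⟶ M, ∃ h : J.X 0 ⟶ M, ι ≫ h = g
  exists_desc_zero : ∀ g : J.X 0 ⟶ M, ι ≫ g = 0 → ∃ h : J.X 1 ⟶ M, J.d 0 1 ≫ h = g
  exists_desc : ∀ i j k : ℤ, 0 ≤ i → i + 1 = j → j + 1 = k → ∀ g : J.X j ⟶ M,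
    J.d i j ≫ g = 0 → ∃ h : J.X k ⟶ M, J.d j k ≫ h = g

/-- Stated through Hom-exactness in an arbitrary preadditive category, so that it serves both for
rows, as objects of the category of complexes, and for columns, over `A`. -/
theorem exists_lift_of_isHomExact {J I : CochainComplex E ℤ} {X : E} {ι : X ⟶ J.X 0}
    (hJ : ∀ i : ℤ, i < 0 → IsZero (J.X i))
    (hJI : ∀ i : ℤ, 0 ≤ i → IsHomExact J ι (I.X i)) (f : X ⟶ I.X 0) (hf : f ≫ I.d 0 1 = 0) :
    ∃ φ : J ⟶ I, ι ≫ φ.f 0 = f := by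
  obtain ⟨φ₀, hφ₀⟩ := (hJI 0 le_rfl).exists_extension f
  obtain ⟨s, hs₀, hs⟩ := exists_seq_of_forall_exists
    (α := fun n : ℕ => J.X (n : ℤ) ⟶ I.X (n : ℤ))
    (R := fun n φ ψ => J.d n (n + 1 : ℕ) ≫ ψ = φ ≫ I.d n (n + 1 : ℕ))
    -- The invariant is that the next component exists; the recursion only selects it.
    (P := fun n φ => ∃ ψ : J.X (n + 1 : ℕ) ⟶ I.X (n + 1 : ℕ),
      J.d n (n + 1 : ℕ) ≫ ψ = φ ≫ I.d n (n + 1 : ℕ)) φ₀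
    ((hJI _ (by positivity)).exists_desc_zero _ (by
      rw [← Category.assoc]; erw [hφ₀, hf]))
    (by
      rintro n φ ⟨ψ, hψ⟩
      refine ⟨ψ, hψ, (hJI _ (by positivity)).exists_desc n _ _ (by positivity) (by simp) (by simp)
        _ ?_⟩
      rw [← Category.assoc, hψ, Category.assoc, I.d_comp_d, comp_zero])
  let t : ∀ k : ℤ, J.X k ⟶ I.X k := fun k => match k with
    | .ofNat n => s n
    | .negSucc _ => 0
  refine ⟨{ f := t, comm' := ?_ }, ?_⟩
  · rintro i j rfl
    cases i with
    | ofNat n => exact (hs n).symm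
    | negSucc n => exact (hJ _ (Int.negSucc_lt_zero n)).eq_of_src _ _
  · change ι ≫ s 0 = f
    rw [hs₀, hφ₀]

theorem nonempty_homotopy_zero_of_isHomExact {J I : CochainComplex E ℤ} {X : E} {ι : X ⟶ J.X 0}
    (hJ : ∀ i : ℤ, i < 0 → IsZero (J.X i))
    (hJI : ∀ i : ℤ, 0 ≤ i → IsHomExact J ι (I.X i)) (φ : J ⟶ I) (hφ : ι ≫ φ.f 0 = 0) :
    Nonempty (Homotopy φ 0) := by
  obtain ⟨h₀, hh₀⟩ := (hJI 0 le_rfl).exists_desc_zero _ hφ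
  obtain ⟨s, hs₀, hs⟩ := exists_seq_of_forall_exists
    (α := fun n : ℕ => J.X (n + 1 : ℕ) ⟶ I.X (n : ℤ))
    (R := fun n h h' => J.d (n + 1 : ℕ) (n + 2 : ℕ) ≫ h' + h ≫ I.d n (n + 1 : ℕ) =
      φ.f (n + 1 : ℕ))
    -- What the homotopy still has to account for in degree `n + 1` is killed by the incoming
    -- differential, hence factors over the outgoing one.
    (P := fun n h => J.d n (n + 1 : ℕ) ≫ (φ.f (n + 1 : ℕ) - h ≫ I.d n (n + 1 : ℕ)) = 0) h₀
    (by
      have : J.d (0 : ℕ) (0 + 1 : ℕ) ≫ h₀ = φ.f (0 : ℕ) := hh₀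
      rw [Preadditive.comp_sub, ← Category.assoc, this, φ.comm, sub_self])
    (by
      intro n h hh
      obtain ⟨h', hh'⟩ := (hJI (n + 1 : ℕ) (by positivity)).exists_desc n _ (n + 2 : ℕ)
        (by positivity) (by simp) (by push_cast; ring) _ hh
      refine ⟨h', by rw [hh', sub_add_cancel], ?_⟩
      rw [Preadditive.comp_sub, ← Category.assoc, hh', Preadditive.sub_comp, Category.assoc,
        I.d_comp_d, comp_zero, sub_zero, φ.comm, sub_self])
  let t : ∀ k : ℤ, J.X (k + 1) ⟶ I.X k := fun k => match k with
    | .ofNat n => s n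
    | .negSucc _ => 0
  let t' : ∀ i j : ℤ, (ComplexShape.up ℤ).Rel j i → (J.X i ⟶ I.X j) := fun i j hij =>
    eqToHom (by rw [← show j + 1 = i from hij]) ≫ t j
  refine ⟨(Homotopy.ofEq ?_).trans (Homotopy.nullHomotopy' t')⟩
  ext k
  rw [Homotopy.nullHomotopicMap'_f (show (ComplexShape.up ℤ).Rel (k - 1) k by simp)
    (show (ComplexShape.up ℤ).Rel k (k + 1) by simp)]
  cases k with
  | negSucc n => exact (hJ _ (Int.negSucc_lt_zero n)).eq_of_src _ _
  | ofNat n =>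
    have h₁ : t' (Int.ofNat n + 1) (Int.ofNat n) rfl = s n := Category.id_comp _
    rw [h₁]
    cases n with
    | zero =>
      have h₂ : t' (Int.ofNat 0) (Int.ofNat 0 - 1) (by simp) = 0 := comp_zero
      rw [h₂, zero_comp, add_zero, hs₀]
      exact hh₀.symm
    | succ n =>
      have h₂ : ∀ (l : ℤ) (hl : (ComplexShape.up ℤ).Rel l (Int.ofNat (n + 1))),
          t' _ l hl ≫ I.d l (Int.ofNat (n + 1)) = s n ≫ I.d (n : ℤ) (n + 1 : ℕ) := by
        intro l hl
        obtain rfl : l = Int.ofNat n := by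
          have : l + 1 = _ := hl
          simp at this ⊢
          omega
        simp only [t']
        erw [Category.id_comp]
        rfl
      rw [h₂ _ (by simp)]
      exact (hs n).symm

/-! ### Split acyclic complexes and null-homotopic morphisms -/

variable [HasBinaryBiproducts E]

theorem splitAcyclicComplex_d (T : ℤ → E) (i : ℤ) : (splitAcyclicComplex T).d i (i + 1) =
    (biprod.snd ≫ biprod.inl : T i ⊞ T (i + 1) ⟶ T (i + 1) ⊞ T (i + 1 + 1)) := by
  simp only [splitAcyclicComplex, CochainComplex.of_d]

/-- The first projection from an entry of `splitAcyclicComplex T`. -/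
noncomputable def splitAcyclicComplexFst (T : ℤ → E) (i : ℤ) : (splitAcyclicComplex T).X i ⟶ T i :=
  (biprod.fst : T i ⊞ T (i + 1) ⟶ T i)

/-- The second projection from an entry of `splitAcyclicComplex T`. -/
noncomputable def splitAcyclicComplexSnd (T : ℤ → E) (i : ℤ) :
    (splitAcyclicComplex T).X i ⟶ T (i + 1) :=
  (biprod.snd : T i ⊞ T (i + 1) ⟶ T (i + 1))

theorem splitAcyclicComplex_hom_ext {T : ℤ → E} {i : ℤ} {W : E}
    {g h : W ⟶ (splitAcyclicComplex T).X i}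
    (h₁ : g ≫ splitAcyclicComplexFst T i = h ≫ splitAcyclicComplexFst T i)
    (h₂ : g ≫ splitAcyclicComplexSnd T i = h ≫ splitAcyclicComplexSnd T i) : g = h :=
  biprod.hom_ext (X := T i) (Y := T (i + 1)) g h h₁ h₂

theorem splitAcyclicComplex_d_fst (T : ℤ → E) (i : ℤ) :
    (splitAcyclicComplex T).d i (i + 1) ≫ splitAcyclicComplexFst T (i + 1) =
      splitAcyclicComplexSnd T i := by
  rw [splitAcyclicComplex_d]
  have : (biprod.snd ≫ biprod.inl : T i ⊞ T (i + 1) ⟶ T (i + 1) ⊞ T (i + 1 + 1)) ≫ biprod.fst =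
    biprod.snd := by simp
  exact this

theorem splitAcyclicComplex_d_snd (T : ℤ → E) (i : ℤ) :
    (splitAcyclicComplex T).d i (i + 1) ≫ splitAcyclicComplexSnd T (i + 1) = 0 := by
  rw [splitAcyclicComplex_d]
  have : (biprod.snd ≫ biprod.inl : T i ⊞ T (i + 1) ⟶ T (i + 1) ⊞ T (i + 1 + 1)) ≫ biprod.snd =
    0 := by simp
  exact this

/-- The morphism to an entry of `splitAcyclicComplex T` with given components. -/
noncomputable def splitAcyclicComplexLift {T : ℤ → E} {i : ℤ} {W : E} (a : W ⟶ T i)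
    (b : W ⟶ T (i + 1)) : W ⟶ (splitAcyclicComplex T).X i :=
  biprod.lift a b

theorem splitAcyclicComplexLift_fst {T : ℤ → E} {i : ℤ} {W : E} (a : W ⟶ T i)
    (b : W ⟶ T (i + 1)) : splitAcyclicComplexLift a b ≫ splitAcyclicComplexFst T i = a :=
  biprod.lift_fst _ _

theorem splitAcyclicComplexLift_snd {T : ℤ → E} {i : ℤ} {W : E} (a : W ⟶ T i)
    (b : W ⟶ T (i + 1)) : splitAcyclicComplexLift a b ≫ splitAcyclicComplexSnd T i = b :=
  biprod.lift_snd _ _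

/-- A morphism to `splitAcyclicComplex T` is given by a family of morphisms to the `T i`. -/
noncomputable def toSplitAcyclicComplex {X : CochainComplex E ℤ} {T : ℤ → E}
    (a : ∀ i, X.X i ⟶ T i) : X ⟶ splitAcyclicComplex T where
  -- The second component is forced: the differential of the target carries it to the first
  -- component one degree higher.
  f i := splitAcyclicComplexLift (a i) (X.d i (i + 1) ≫ a (i + 1))
  comm' := by
    rintro i j rfl
    apply splitAcyclicComplex_hom_ext
    · rw [Category.assoc, splitAcyclicComplex_d_fst, splitAcyclicComplexLift_snd, Category.assoc,
        splitAcyclicComplexLift_fst]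
    · rw [Category.assoc, splitAcyclicComplex_d_snd, Category.assoc, splitAcyclicComplexLift_snd,
        X.d_comp_d_assoc, zero_comp, comp_zero]

theorem toSplitAcyclicComplex_f_fst {X : CochainComplex E ℤ} {T : ℤ → E}
    (a : ∀ i, X.X i ⟶ T i) (i : ℤ) :
    (toSplitAcyclicComplex a).f i ≫ splitAcyclicComplexFst T i = a i :=
  biprod.lift_fst _ _

theorem toSplitAcyclicComplex_f_snd {X : CochainComplex E ℤ} {T : ℤ → E}
    (a : ∀ i, X.X i ⟶ T i) (i : ℤ) :
    (toSplitAcyclicComplex a).f i ≫ splitAcyclicComplexSnd T i = X.d i (i + 1) ≫ a (i + 1) :=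
  biprod.lift_snd _ _

theorem toSplitAcyclicComplex_comp_fst {X : CochainComplex E ℤ} {T : ℤ → E}
    (g : X ⟶ splitAcyclicComplex T) :
    toSplitAcyclicComplex (fun i => g.f i ≫ splitAcyclicComplexFst T i) = g := by
  ext i
  apply splitAcyclicComplex_hom_ext
  · exact toSplitAcyclicComplex_f_fst _ i
  · rw [toSplitAcyclicComplex_f_snd, ← g.comm_assoc, splitAcyclicComplex_d_fst]

/-- With `T = J.X`, the map `(1, d)` followed by the map with components `h d` and `h` is `h d + d h
= φ`. -/
theorem exists_factorization_of_homotopy_zero {J I : CochainComplex E ℤ} {φ : J ⟶ I}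
    (h : Homotopy φ 0) :
    ∃ (T : ℤ → E) (a : J ⟶ splitAcyclicComplex T) (b : splitAcyclicComplex T ⟶ I), φ = a ≫ b := by
  refine ⟨J.X, toSplitAcyclicComplex (fun i => 𝟙 (J.X i)),
    { f := fun i => biprod.desc (h.hom i (i - 1) ≫ I.d (i - 1) i) (h.hom (i + 1) i)
      comm' := ?_ }, ?_⟩
  · rintro i j rfl
    simp only [splitAcyclicComplex, CochainComplex.of_d]
    apply biprod.hom_ext'
    · simp
    · have (j : ℤ) (hj : j = i) : h.hom (i + 1) j ≫ I.d j (i + 1) =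
        h.hom (i + 1) i ≫ I.d i (i + 1) := by rw [hj]
      simp [this (i + 1 - 1) (by ring)]
  · ext i
    have := h.comm i
    rw [dNext_eq _ (show (ComplexShape.up ℤ).Rel i (i + 1) by simp),
      prevD_eq _ (show (ComplexShape.up ℤ).Rel (i - 1) i by simp)] at this
    rw [this]
    change _ = biprod.lift (𝟙 _) _ ≫ biprod.desc _ _
    rw [biprod.lift_desc]
    simp [add_comm]

/-- The contraction of `splitAcyclicComplex T`, in one degree. -/
noncomputable def splitAcyclicComplexContraction (T : ℤ → E) (i j : ℤ)
    (hij : (ComplexShape.up ℤ).Rel j i) :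
    (splitAcyclicComplex T).X i ⟶ (splitAcyclicComplex T).X j :=
  (biprod.fst ≫ eqToHom (by rw [show j + 1 = i from hij]) ≫ biprod.inr :
    T i ⊞ T (i + 1) ⟶ T j ⊞ T (j + 1))

/-- The complexes `splitAcyclicComplex T` are contractible. -/
noncomputable def splitAcyclicComplexHomotopy (T : ℤ → E) :
    Homotopy (𝟙 (splitAcyclicComplex T)) 0 :=
  (Homotopy.ofEq (by
    ext k
    obtain ⟨l, rfl⟩ : ∃ l, k = l + 1 := ⟨k - 1, by ring⟩
    rw [Homotopy.nullHomotopicMap'_f (show (ComplexShape.up ℤ).Rel l (l + 1) by simp)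
      (show (ComplexShape.up ℤ).Rel (l + 1) (l + 1 + 1) by simp), splitAcyclicComplex_d,
      splitAcyclicComplex_d]
    have : 𝟙 (T (l + 1) ⊞ T (l + 1 + 1)) =
        (biprod.snd ≫ biprod.inl : _ ⟶ T (l + 1 + 1) ⊞ T (l + 1 + 1 + 1)) ≫ biprod.fst ≫ 𝟙 _ ≫
          biprod.inr +
        (biprod.fst ≫ 𝟙 _ ≫ biprod.inr : _ ⟶ T l ⊞ T (l + 1)) ≫ biprod.snd ≫ biprod.inl := by
      ext <;> simp
    exact this)).trans
  (Homotopy.nullHomotopy' (splitAcyclicComplexContraction T))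

end Comparison

end CERes

/-! ### Pure monomorphisms and relatively injective complexes -/

namespace CERes

section Pure

variable {A : Type u} [Category.{v} A] [Abelian A]

open HomologicalComplex
open scoped ZeroObject

/-- The connecting morphism followed by the homology map of `f` is zero, and the latter is monic. -/
theorem isPureShortExact_cokernel {X Y : CochainComplex A ℤ} (f : X ⟶ Y) [Mono f]
    (h : ∀ i, Mono (homologyMap f i)) :
    IsPureShortExact (ShortComplex.mk f (cokernel.π f) (cokernel.condition f)) := by
  have hS : (ShortComplex.mk f (cokernel.π f) (cokernel.condition f)).ShortExact :=
    { exact := ShortComplex.exact_cokernel f }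
  refine ⟨hS, fun i j hij => ?_⟩
  have := h j
  rw [← cancel_mono (homologyMap f j), zero_comp]
  exact hS.δ_comp i j hij

theorem isPureMono_of_mono {X Y : CochainComplex A ℤ} (f : X ⟶ Y) [Mono f]
    (h : ∀ i, Mono (homologyMap f i)) : IsPureMono f :=
  ⟨_, _, _, isPureShortExact_cokernel f h⟩

theorem IsPureMono.mono {X Y : CochainComplex A ℤ} {f : X ⟶ Y} (hf : IsPureMono f) : Mono f := by
  obtain ⟨Z, g, w, hS, -⟩ := hf
  exact hS.mono_f

theorem IsPureMono.mono_homologyMap {X Y : CochainComplex A ℤ} {f : X ⟶ Y} (hf : IsPureMono f)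
    (i : ℤ) : Mono (homologyMap f i) := by
  obtain ⟨Z, g, w, hS, hδ⟩ := hf
  exact (hS.homology_exact₁ (i - 1) i (by simp)).mono_g (hδ _ _ _)

theorem IsPureEpi.epi {X Y : CochainComplex A ℤ} {f : X ⟶ Y} (hf : IsPureEpi f) : Epi f := by
  obtain ⟨Z, g, w, hS, -⟩ := hf
  exact hS.epi_g

/-- The kernel of `opcycles i ⟶ X.X (i + 1)` is the homology in degree `i`, so injectivity can be
tested on these two neighbours. -/
theorem mono_opcyclesMap {X Y : CochainComplex A ℤ} (f : X ⟶ Y) (i : ℤ) (h : Mono (f.f (i + 1)))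
    (h' : Mono (homologyMap f i)) : Mono (opcyclesMap f i) := by
  refine Preadditive.mono_of_cancel_zero _ fun {W} a ha => ?_
  have h₁ : a ≫ X.fromOpcycles i (i + 1) = 0 := by
    have : X.fromOpcycles i (i + 1) ≫ f.f (i + 1) =
        opcyclesMap f i ≫ Y.fromOpcycles i (i + 1) := by
      simp [← cancel_epi (X.pOpcycles i)]
    rw [← cancel_mono (f.f (i + 1)), Category.assoc, this, reassoc_of% ha, zero_comp, zero_comp]
  obtain ⟨b, rfl⟩ : ∃ b, b ≫ X.homologyι i = a :=
    ⟨_, (X.homologyIsKernel i (i + 1) (by simp)).fac (KernelFork.ofι a h₁) WalkingParallelPair.zero⟩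
  have : b = 0 := by
    rw [← cancel_mono (homologyMap f i), ← cancel_mono (Y.homologyι i), Category.assoc,
      homologyι_naturality, ← Category.assoc, ha, zero_comp, zero_comp]
  rw [this, zero_comp]

/-- Morphisms to a complex with zero differential are families of morphisms from the opcycles, and a
pure monomorphism is monic on opcycles. -/
theorem isRelativelyInjective_of_d_eq_zero {Z : CochainComplex A ℤ} (hZ : ∀ i j, Z.d i j = 0)
    (hZ' : ∀ i, Injective (Z.X i)) : IsRelativelyInjective Z := by
  intro X Y f hf g
  have hg (i : ℤ) : X.d (i - 1) i ≫ g.f i = 0 := by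
    rw [← g.comm, hZ, comp_zero]
  have (i : ℤ) : Mono (opcyclesMap f i) :=
    have := hf.mono
    mono_opcyclesMap f i inferInstance (hf.mono_homologyMap i)
  have ext (i : ℤ) : ∃ k : Y.opcycles i ⟶ Z.X i,
      opcyclesMap f i ≫ k = X.descOpcycles (g.f i) (i - 1) (by simp) (hg i) :=
    ⟨Injective.factorThru _ (opcyclesMap f i), Injective.comp_factorThru _ _⟩
  choose k hk using ext
  refine ⟨{ f := fun i => Y.pOpcycles i ≫ k i, comm' := ?_ }, ?_⟩
  · intro i j _
    rw [Y.d_pOpcycles_assoc, zero_comp, hZ, comp_zero]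
  · ext i
    rw [comp_f, ← p_opcyclesMap_assoc, hk, p_descOpcycles]

/-- Morphisms to `splitAcyclicComplex T` are arbitrary families `X.X i ⟶ T i`, so degreewise
extension suffices. -/
theorem isRelativelyInjective_splitAcyclicComplex (T : ℤ → A) (hT : ∀ i, Injective (T i)) :
    IsRelativelyInjective (splitAcyclicComplex T) := by
  intro X Y f hf g
  have := hf.mono
  have ext (i : ℤ) : ∃ k : Y.X i ⟶ T i,
      f.f i ≫ k = g.f i ≫ splitAcyclicComplexFst T i :=
    ⟨Injective.factorThru _ (f.f i), Injective.comp_factorThru _ _⟩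
  choose k hk using ext
  refine ⟨toSplitAcyclicComplex k, ?_⟩
  rw [← toSplitAcyclicComplex_comp_fst g, ← toSplitAcyclicComplex_comp_fst (f ≫ _)]
  congr 1
  ext i
  rw [comp_f, Category.assoc, toSplitAcyclicComplex_f_fst, hk]

theorem IsRelativelyInjective.biprod {I I' : CochainComplex A ℤ} (h : IsRelativelyInjective I)
    (h' : IsRelativelyInjective I') : IsRelativelyInjective (I ⊞ I') := by
  intro X Y f hf g
  obtain ⟨k, hk⟩ := h f hf (g ≫ biprod.fst)
  obtain ⟨k', hk'⟩ := h' f hf (g ≫ biprod.snd)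
  exact ⟨biprod.lift k k', by apply biprod.hom_ext <;> simp [hk, hk']⟩

/-- The target is a sum of two relatively injective complexes: a split acyclic one that makes the
morphism monic in positive degrees, and one with zero differential that makes it monic on homology.
-/
theorem exists_pureMono_relativelyInjective [EnoughInjectives A] (X : CochainComplex A ℤ)
    (hX : X.IsStrictlyGE 0) : ∃ (I : CochainComplex A ℤ) (f : X ⟶ I), IsPureMono f ∧
      IsRelativelyInjective I ∧ I.IsStrictlyGE 0 ∧ ∀ i, Injective (I.X i) := by
  have hX' (i : ℤ) (hi : i < 0) : IsZero (X.X i) := X.isZero_of_isStrictlyGE 0 i hi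
  -- `E i` occurs in degrees `i - 1` and `i`, so `E 0` must vanish as well for the result to stay in
  -- degrees `≥ 0`.
  have hE (i : ℤ) : ∃ (E : A) (e : X.X i ⟶ E), Injective E ∧ (i ≤ 0 → IsZero E) ∧
      (0 < i → Mono e) := by
    by_cases hi : 0 < i
    · exact ⟨_, Injective.ι (X.X i), inferInstance, fun h => by omega, fun _ => inferInstance⟩
    · exact ⟨(0 : A), 0, inferInstance, fun _ => isZero_zero A, fun h => (hi h).elim⟩
  have hT (i : ℤ) : ∃ (T : A) (t : X.opcycles i ⟶ T), Injective T ∧ (i < 0 → IsZero T) ∧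
      Mono (X.homologyι i ≫ t) := by
    by_cases hi : i < 0
    · have : IsZero (X.homology i) := ShortComplex.isZero_homology_of_isZero_X₂ _ (hX' i hi)
      exact ⟨(0 : A), 0, inferInstance, fun _ => isZero_zero A, ⟨fun _ _ _ => this.eq_of_tgt _ _⟩⟩
    · refine ⟨_, Injective.factorThru (Injective.ι (X.homology i)) (X.homologyι i), inferInstance,
        fun h => (hi h).elim, ?_⟩
      rw [Injective.comp_factorThru]
      infer_instance
  choose E e hE hE₀ he using hE
  obtain ⟨Z, hZ, t, hT, hT₀, ht⟩ : ∃ (Z : CochainComplex A ℤ) (_ : ∀ i j, Z.d i j = 0)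
      (t : ∀ i, X.opcycles i ⟶ Z.X i), (∀ i, Injective (Z.X i)) ∧ (∀ i < 0, IsZero (Z.X i)) ∧
        ∀ i, Mono (X.homologyι i ≫ t i) := by
    choose T t hT hT₀ ht using hT
    exact ⟨{ X := T, d := 0 }, fun _ _ => rfl, t, hT, hT₀, ht⟩
  let a : X ⟶ splitAcyclicComplex E := toSplitAcyclicComplex e
  let b : X ⟶ Z :=
    { f := fun i => X.pOpcycles i ≫ t i
      comm' := fun i j _ => by
        rw [X.d_pOpcycles_assoc, zero_comp, hZ, comp_zero] }
  have hb (i : ℤ) : Mono (homologyMap b i) := by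
    have h₁ : opcyclesMap b i = t i ≫ Z.pOpcycles i := by
      rw [← cancel_epi (X.pOpcycles i), p_opcyclesMap]
      exact Category.assoc _ _ _
    have h₂ : homologyMap b i ≫ Z.homologyι i =
        (X.homologyι i ≫ t i) ≫ Z.pOpcycles i := by
      rw [homologyι_naturality, h₁, Category.assoc]
    have : IsIso (Z.pOpcycles i) :=
      Z.isIso_pOpcycles _ i rfl (hZ _ _)
    have := ht i
    have : Mono (homologyMap b i ≫ Z.homologyι i) := by
      rw [h₂]
      infer_instance
    exact mono_of_mono _ (Z.homologyι i)
  let f : X ⟶ splitAcyclicComplex E ⊞ Z := biprod.lift a b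
  have hf (i : ℤ) : Mono (homologyMap f i) := by
    have := hb i
    have : Mono (homologyMap f i ≫ homologyMap biprod.snd i) := by
      rw [← homologyMap_comp, biprod.lift_snd]
      infer_instance
    exact mono_of_mono _ (homologyMap biprod.snd i)
  have hf₁ (i : ℤ) (hi : 0 < i) : Mono (f.f i) := by
    have := he i hi
    let q := (biprod.fst : splitAcyclicComplex E ⊞ Z ⟶ _).f i ≫ splitAcyclicComplexFst E i
    have : Mono (f.f i ≫ q) := by
      rw [← Category.assoc, ← comp_f, biprod.lift_fst, toSplitAcyclicComplex_f_fst]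
      infer_instance
    exact mono_of_mono _ q
  have : Mono f := by
    refine mono_of_mono_f _ fun i => ?_
    obtain hi | rfl | hi := lt_trichotomy i 0
    · exact ⟨fun _ _ _ => (hX' i hi).eq_of_tgt _ _⟩
    -- As `E 0` is zero, monicity in degree `0` is obtained from opcycles, which agree with `X.X 0`
    -- since `X.X (-1)` is zero.
    · have : Mono (opcyclesMap f 0) := mono_opcyclesMap f 0 (hf₁ _ (by simp)) (hf 0)
      have : IsIso (X.pOpcycles 0) :=
        X.isIso_pOpcycles (-1) 0 (by simp) ((hX' (-1) (by simp)).eq_of_src _ _)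
      have : Mono (f.f 0 ≫ pOpcycles _ 0) := by
        rw [← p_opcyclesMap]
        infer_instance
      exact mono_of_mono _ (pOpcycles _ 0)
    · exact hf₁ i hi
  have iso (i : ℤ) : (splitAcyclicComplex E ⊞ Z).X i ≅
    (E i ⊞ E (i + 1)) ⊞ Z.X i := (eval A (ComplexShape.up ℤ) i).mapBiprod _ _
  refine ⟨_, f, isPureMono_of_mono f hf, (isRelativelyInjective_splitAcyclicComplex E hE).biprod
    (isRelativelyInjective_of_d_eq_zero hZ hT), ?_, fun i => ?_⟩
  · rw [CochainComplex.isStrictlyGE_iff]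
    intro i hi
    refine IsZero.of_iso ?_ (iso i)
    rw [biprod_isZero_iff, biprod_isZero_iff]
    exact ⟨⟨hE₀ i hi.le, hE₀ (i + 1) (by omega)⟩, hT₀ i hi⟩
  · exact Injective.of_iso (iso i).symm inferInstance

/-- `I` is a retract of a complex with injective entries. This makes the columns of a first quadrant
Cartan–Eilenberg resolution complexes of injectives. -/
theorem IsRelativelyInjective.injective_X [EnoughInjectives A] {I : CochainComplex A ℤ}
    (hI : IsRelativelyInjective I) (hI' : I.IsStrictlyGE 0) (i : ℤ) : Injective (I.X i) := by
  obtain ⟨L, f, hf, -, -, hL⟩ := exists_pureMono_relativelyInjective I hI'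
  obtain ⟨r, hr⟩ := hI f hf (𝟙 I)
  have := hL i
  exact (Retract.mk (f.f i) (r.f i) (by rw [← comp_f, hr, id_f])).injective

end Pure

end CERes

/-! ### Augmentation of a double complex and Hom-exactness of resolutions -/

namespace CERes

section Augmentation

variable {A : Type u} [Category.{v} A] [Abelian A]

open HomologicalComplex

/-- The inclusion of `H^0` of a complex `K` into `K.X 0`, if there are no coboundaries. -/
noncomputable def homologyZeroι (K : CochainComplex A ℤ) (hK : K.d (-1) 0 = 0) :
    K.homology 0 ⟶ K.X 0 :=
  (K.isoHomologyπ (-1) 0 (by simp) hK).inv ≫ K.iCycles 0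

instance mono_homologyZeroι (K : CochainComplex A ℤ) (hK : K.d (-1) 0 = 0) : Mono (homologyZeroι K hK) := by
  unfold homologyZeroι
  infer_instance

theorem homologyZeroι_d (K : CochainComplex A ℤ) (hK : K.d (-1) 0 = 0) (j : ℤ) :
    homologyZeroι K hK ≫ K.d 0 j = 0 := by
  simp [homologyZeroι]

theorem homologyZeroι_exact (K : CochainComplex A ℤ) (hK : K.d (-1) 0 = 0) :
    (ShortComplex.mk _ _ (homologyZeroι_d K hK 1)).Exact := by
  apply ShortComplex.exact_of_f_is_kernel
  refine IsLimit.ofIsoLimit (K.cyclesIsKernel 0 1 (by simp))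
    (Fork.ext (K.isoHomologyπ (-1) 0 (by simp) hK) ?_)
  change (K.isoHomologyπ (-1) 0 (by simp) hK).hom ≫ homologyZeroι K hK = K.iCycles 0
  simp [homologyZeroι]

theorem homologyZeroι_naturality {K L : CochainComplex A ℤ} (f : K ⟶ L) (hK : K.d (-1) 0 = 0)
    (hL : L.d (-1) 0 = 0) :
    homologyMap f 0 ≫ homologyZeroι L hL = homologyZeroι K hK ≫ f.f 0 := by
  have h : homologyMap f 0 ≫ (L.isoHomologyπ (-1) 0 (by simp) hL).inv =
      (K.isoHomologyπ (-1) 0 (by simp) hK).inv ≫ cyclesMap f 0 := by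
    rw [Iso.comp_inv_eq, Category.assoc, isoHomologyπ_hom, ← homologyπ_naturality,
      isoHomologyπ_inv_hom_id_assoc]
  rw [homologyZeroι, homologyZeroι, reassoc_of% h, cyclesMap_i, Category.assoc]

theorem flip_d_eq_zero {J : DoubleComplex A} (hJ : J.d (-1) 0 = 0) (j : ℤ) :
    ((HomologicalComplex₂.flip J).X j).d (-1) 0 = 0 :=
  congr_hom hJ j

/-- The inclusion of columnwise `H^0` of a double complex `J` into the row `J.X 0`, if there are no
vertical coboundaries. -/
noncomputable def augmentation (J : DoubleComplex A) (hJ : J.d (-1) 0 = 0) :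
    (columnwiseHZero A).obj J ⟶ J.X 0 where
  f j := homologyZeroι ((HomologicalComplex₂.flip J).X j) (flip_d_eq_zero hJ j)
  comm' i j _ := (homologyZeroι_naturality ((HomologicalComplex₂.flip J).d i j)
    (flip_d_eq_zero hJ i) (flip_d_eq_zero hJ j)).symm

theorem augmentation_naturality {J J' : DoubleComplex A} (φ : J ⟶ J') (hJ : J.d (-1) 0 = 0)
    (hJ' : J'.d (-1) 0 = 0) :
    (columnwiseHZero A).map φ ≫ augmentation J' hJ' = augmentation J hJ ≫ φ.f 0 := by
  ext j
  exact homologyZeroι_naturality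
    (((HomologicalComplex₂.flipFunctor A (ComplexShape.up ℤ) (ComplexShape.up ℤ)).map φ).f j) _ _

instance (J : DoubleComplex A) (hJ : J.d (-1) 0 = 0) : Mono (augmentation J hJ) :=
  mono_of_mono_f _ fun j => mono_homologyZeroι _ (flip_d_eq_zero hJ j)

theorem augmentation_d (J : DoubleComplex A) (hJ : J.d (-1) 0 = 0) :
    augmentation J hJ ≫ J.d 0 1 = 0 := by
  ext j
  exact homologyZeroι_d _ (flip_d_eq_zero hJ j) 1

theorem augmentation_exact (J : DoubleComplex A) (hJ : J.d (-1) 0 = 0) :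
    (ShortComplex.mk _ _ (augmentation_d J hJ)).Exact :=
  exact_of_degreewise_exact _ fun j => homologyZeroι_exact _ (flip_d_eq_zero hJ j)

/-- By exactness `g` descends along the pure epimorphism in `d`; relative injectivity extends the
result along the pure monomorphism. -/
theorem IsRelativelyInjective.exists_desc_of_isPure {I X Y Z : CochainComplex A ℤ}
    (hI : IsRelativelyInjective I) {f : X ⟶ Y} {d : Y ⟶ Z} (w : f ≫ d = 0)
    (h : (ShortComplex.mk f d w).Exact) (hd : IsPure d) (g : Y ⟶ I) (hg : f ≫ g = 0) :
    ∃ k : Z ⟶ I, d ≫ k = g := by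
  obtain ⟨T, p, i, hp, hi, rfl⟩ := hd
  have := hp.epi
  have := hi.mono
  have w' : f ≫ p = 0 := by
    rw [← cancel_mono i, Category.assoc, w, zero_comp]
  have h' : (ShortComplex.mk f p w').Exact :=
    (ShortComplex.exact_iff_of_epi_of_isIso_of_mono
      (S₁ := ShortComplex.mk f p w') (S₂ := ShortComplex.mk f (p ≫ i) w)
      { τ₁ := 𝟙 _, τ₂ := 𝟙 _, τ₃ := i }).2 h
  obtain ⟨l, hl⟩ := h'.desc' g hg
  obtain ⟨k, hk⟩ := hI i hi l
  exact ⟨k, by rw [Category.assoc, hk]; exact hl⟩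

namespace IsCartanEilenbergResolution

variable {X : CochainComplex A ℤ} {J : DoubleComplex A}
  {ε : (HomologicalComplex.single (CochainComplex A ℤ) (ComplexShape.up ℤ) 0).obj X ⟶ J}

theorem d_eq_zero (h : IsCartanEilenbergResolution X J ε) : J.d (-1) 0 = 0 :=
  (h.zero_of_neg (-1) (by simp)).eq_of_src _ _

theorem ε_d (ε : (HomologicalComplex.single (CochainComplex A ℤ) (ComplexShape.up ℤ) 0).obj X ⟶ J) :
    ε.f 0 ≫ J.d 0 1 = 0 := by
  simp

theorem ε_exact (h : IsCartanEilenbergResolution X J ε) :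
    (ShortComplex.mk _ _ (ε_d ε)).Exact := by
  have := h.quasiIso
  have h₁ : QuasiIsoAt ε 0 := inferInstance
  rw [quasiIsoAt_iff' ε (-1) 0 1 (by simp) (by simp),
    ShortComplex.quasiIso_iff_of_zeros _ rfl rfl h.d_eq_zero] at h₁
  exact h₁.1

theorem exact (h : IsCartanEilenbergResolution X J ε) (i j k : ℤ) (hi : 0 ≤ i) (hij : i + 1 = j)
    (hjk : j + 1 = k) : (ShortComplex.mk _ _ (J.d_comp_d i j k)).Exact := by
  have := h.quasiIso
  have h₁ : QuasiIsoAt ε j := inferInstance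
  rw [quasiIsoAt_iff_exactAt _ _ (exactAt_single_obj _ _ _ _ (by omega)),
    J.exactAt_iff' i j k (by simp [← hij]) (by simp [← hjk])] at h₁
  exact h₁

theorem isHomExact (h : IsCartanEilenbergResolution X J ε) {M : CochainComplex A ℤ}
    (hM : IsRelativelyInjective M) : IsHomExact J (augmentation J h.d_eq_zero) M where
  exists_extension g := by
    have := (h.pureMono 0).mono
    -- The augmentation and `ε.f 0` are both kernels of `J.d 0 1`, and it is `ε.f 0` that is known
    -- to be purely monic.
    obtain ⟨a, ha : a ≫ augmentation J _ = ε.f 0⟩ :=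
      (augmentation_exact J h.d_eq_zero).lift' (ε.f 0) (ε_d ε)
    obtain ⟨b, hb : b ≫ ε.f 0 = _⟩ := h.ε_exact.lift' _ (augmentation_d J h.d_eq_zero)
    obtain ⟨k, hk⟩ := hM _ (h.pureMono 0) (a ≫ g)
    have hba : b ≫ a = 𝟙 _ := by
      rw [← cancel_mono (augmentation J h.d_eq_zero), Category.assoc, ha, hb, Category.id_comp]
    exact ⟨k, by rw [← hb, Category.assoc, hk, reassoc_of% hba]⟩
  exists_desc_zero g hg :=
    hM.exists_desc_of_isPure _ (augmentation_exact J h.d_eq_zero) (h.pure_d 0) g hg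
  exists_desc i j k hi hij hjk g hg :=
    hM.exists_desc_of_isPure _ (h.exact i j k hi hij hjk) (by subst hjk; exact h.pure_d j) g hg

/-- Over `A` ordinary exactness of the augmented columns is enough; purity plays no role. -/
theorem isHomExact_column (h : IsCartanEilenbergResolution X J ε) (j : ℤ) {M : A}
    [Injective M] : IsHomExact ((HomologicalComplex₂.flip J).X j)
      (homologyZeroι _ (flip_d_eq_zero h.d_eq_zero j)) M where
  exists_extension g := ⟨Injective.factorThru g _, Injective.comp_factorThru _ _⟩
  exists_desc_zero g hg :=
    ⟨_, (homologyZeroι_exact _ (flip_d_eq_zero h.d_eq_zero j)).comp_descToInjective g hg⟩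
  exists_desc i k l hi hik hkl g hg :=
    ⟨_, ((h.exact i k l hi hik hkl).map (eval A (ComplexShape.up ℤ) j)).comp_descToInjective g hg⟩

end IsCartanEilenbergResolution

end Augmentation

end CERes

/-! ### The induced functor, its fullness and faithfulness -/

namespace CERes

section Functor

variable (A : Type u) [Category.{v} A] [Abelian A]

open HomologicalComplex

instance : (HomologicalComplex₂.flipFunctor A (ComplexShape.up ℤ) (ComplexShape.up ℤ)).Additive where
  map_add := rfl

instance : (columnwiseHZero A).Additive := by
  unfold columnwiseHZero
  infer_instance

/-- The residue class in the homotopy category of columnwise `H^0`. -/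
noncomputable def columnwiseHZeroQuotient :
    DoubleComplex A ⥤ HomotopyCategory A (ComplexShape.up ℤ) :=
  columnwiseHZero A ⋙ HomotopyCategory.quotient A (ComplexShape.up ℤ)

instance : (columnwiseHZeroQuotient A).Additive := by
  unfold columnwiseHZeroQuotient
  infer_instance

variable {A}

/-- As a complex of columns, such a double complex is contractible, and the additive functor `H^0`,
applied entrywise, preserves the contraction. -/
theorem isZero_columnwiseHZeroQuotient_of_isHorizontallySplitAcyclic {X : DoubleComplex A}
    (hX : IsHorizontallySplitAcyclic X) : IsZero ((columnwiseHZeroQuotient A).obj X) := by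
  obtain ⟨T, ⟨e⟩⟩ := hX
  refine IsZero.of_iso ?_ ((columnwiseHZeroQuotient A).mapIso e)
  let G := (homologyFunctor A (ComplexShape.up ℤ) 0).mapHomologicalComplex (ComplexShape.up ℤ)
  change IsZero ((HomotopyCategory.quotient A (ComplexShape.up ℤ)).obj
    (G.obj (splitAcyclicComplex T)))
  rw [IsZero.iff_id_eq_zero, ← CategoryTheory.Functor.map_id, HomotopyCategory.quotient_map_eq_zero_iff,
    ← G.map_id]
  exact ⟨((homologyFunctor A (ComplexShape.up ℤ) 0).mapHomotopy
    (splitAcyclicComplexHomotopy T)).trans (Homotopy.ofEq (by ext; simp))⟩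

/-- Each column is contractible, so its `H^0` vanishes. -/
theorem isZero_columnwiseHZeroQuotient_of_isVerticallySplitAcyclic {X : DoubleComplex A}
    (hX : IsVerticallySplitAcyclic X) : IsZero ((columnwiseHZeroQuotient A).obj X) := by
  obtain ⟨T, ⟨e⟩⟩ := hX
  refine IsZero.of_iso ?_ ((columnwiseHZeroQuotient A).mapIso e)
  refine (HomotopyCategory.quotient A (ComplexShape.up ℤ)).map_isZero ?_
  rw [IsZero.iff_id_eq_zero]
  ext j
  let ev := (eval A (ComplexShape.up ℤ) j).mapHomologicalComplex (ComplexShape.up ℤ)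
  have h : Homotopy (𝟙 (ev.obj (splitAcyclicComplex T))) 0 :=
    (Homotopy.ofEq (ev.map_id _).symm).trans
      (((eval A (ComplexShape.up ℤ) j).mapHomotopy (splitAcyclicComplexHomotopy T)).trans
        (Homotopy.ofEq (by ext; simp)))
  have h' : IsZero ((ev.obj (splitAcyclicComplex T)).homology 0) := by
    rw [IsZero.iff_id_eq_zero, ← homologyMap_id, h.homologyMap_eq 0, homologyMap_zero]
  exact h'.eq_of_src _ _

theorem isZero_columnwiseHZeroQuotient {X : DoubleComplex A} (hX : isSplitAcyclic A X) :
    IsZero ((columnwiseHZeroQuotient A).obj X) := by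
  obtain ⟨H, V, hH, hV, ⟨e⟩⟩ := hX
  refine IsZero.of_iso ?_ ((columnwiseHZeroQuotient A).mapIso e)
  rw [IsZero.iff_id_eq_zero, ← CategoryTheory.Functor.map_id, ← biprod.total, Functor.map_add,
    Functor.map_comp, Functor.map_comp,
    (isZero_columnwiseHZeroQuotient_of_isHorizontallySplitAcyclic hH).eq_of_tgt
      ((columnwiseHZeroQuotient A).map biprod.fst) 0,
    (isZero_columnwiseHZeroQuotient_of_isVerticallySplitAcyclic hV).eq_of_tgt
      ((columnwiseHZeroQuotient A).map biprod.snd) 0, zero_comp, zero_comp, add_zero]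

variable (A)

/-- The functor induced by columnwise `H^0` on the homotopy category of double complexes. -/
noncomputable def doubleHomotopyHZero :
    DoubleHomotopyCategory A ⥤ HomotopyCategory A (ComplexShape.up ℤ) :=
  CategoryTheory.Quotient.lift _ (columnwiseHZeroQuotient A) (by
    rintro X Y f g ⟨S, hS, a, b, h⟩
    rw [← sub_eq_zero, ← Functor.map_sub, h, Functor.map_comp,
      (isZero_columnwiseHZeroQuotient hS).eq_of_tgt ((columnwiseHZeroQuotient A).map a) 0,
      zero_comp])

/-- The functor induced by columnwise `H^0` on the homotopy category of Cartan-Eilenberg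
resolutions. -/
noncomputable def ceHomotopyHZero : CEHomotopyCategory A ⥤ HomotopyGEZero A :=
  ObjectProperty.lift _ (ObjectProperty.ι _ ⋙ doubleHomotopyHZero A)
    (fun X => columnwiseHZero_isStrictlyGE X.obj.as X.property.1)

theorem ceQuotient_comp_ceHomotopyHZero :
    ceQuotient A ⋙ ceHomotopyHZero A = ceHZero A ⋙ complexQuotient A :=
  rfl

variable {A}

theorem isFirstQuadrant.isStrictlyGE {J : DoubleComplex A} (hJ : isFirstQuadrant A J) (i : ℤ) :
    CochainComplex.IsStrictlyGE (J.X i) 0 := by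
  rw [CochainComplex.isStrictlyGE_iff]
  exact fun j hj => hJ i j (Or.inr hj)

theorem exists_map_columnwiseHZero_eq {J J' : DoubleComplex A} (hJ : isCE A J) (hJ' : isCE A J')
    (f : (columnwiseHZero A).obj J ⟶ (columnwiseHZero A).obj J') :
    ∃ φ : J ⟶ J', (columnwiseHZero A).map φ = f := by
  obtain ⟨-, X, ε, h⟩ := hJ
  obtain ⟨-, X', ε', h'⟩ := hJ'
  obtain ⟨φ, hφ⟩ := exists_lift_of_isHomExact h.zero_of_neg
    (fun i _ => h.isHomExact (h'.injective i)) (f ≫ augmentation J' h'.d_eq_zero)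
    (by rw [Category.assoc, augmentation_d, comp_zero])
  refine ⟨φ, ?_⟩
  rw [← cancel_mono (augmentation J' h'.d_eq_zero), augmentation_naturality φ h.d_eq_zero, hφ]

/-- A morphism of double complexes is determined by the morphism of flipped double complexes. -/
def unflip {K L : DoubleComplex A} (f : HomologicalComplex₂.flip K ⟶ HomologicalComplex₂.flip L) :
    K ⟶ L :=
  (HomologicalComplex₂.flipFunctor A (ComplexShape.up ℤ) (ComplexShape.up ℤ)).map f

theorem isSplitAcyclic_biprod {H V : DoubleComplex A} (hH : IsHorizontallySplitAcyclic H)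
    (hV : IsVerticallySplitAcyclic V) : isSplitAcyclic A (H ⊞ V) :=
  ⟨H, V, hH, hV, ⟨Iso.refl _⟩⟩

variable [EnoughInjectives A]

theorem exists_factorization_of_homotopy {J J' : DoubleComplex A} (hJ : isCE A J)
    (hJ' : isCE A J') (χ : J ⟶ J') (H : Homotopy ((columnwiseHZero A).map χ) 0) :
    ∃ (S : DoubleComplex A) (_ : isSplitAcyclic A S) (a : J ⟶ S) (b : S ⟶ J'), χ = a ≫ b := by
  obtain ⟨hJ₀, X, ε, h⟩ := hJ
  obtain ⟨hJ₀', X', ε', h'⟩ := hJ'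
  let a := augmentation J h.d_eq_zero
  let a' := augmentation J' h'.d_eq_zero
  -- Every component of `H` lifts to a morphism from an injective resolution to a complex of
  -- injectives.
  have lift (i j : ℤ) : ∃ φ : (HomologicalComplex₂.flip J).X i ⟶ (HomologicalComplex₂.flip J').X j,
      homologyZeroι _ (flip_d_eq_zero h.d_eq_zero i) ≫ φ.f 0 = H.hom i j ≫ a'.f j := by
    refine exists_lift_of_isHomExact (fun k hk => hJ₀ k i (Or.inl hk)) (fun k _ => ?_) _ ?_
    · have : Injective (((HomologicalComplex₂.flip J').X j).X k) :=
        (h'.injective k).injective_X (hJ₀'.isStrictlyGE k) j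
      exact h.isHomExact_column i
    · have h₁ : a'.f j ≫ (J'.d 0 1).f j = 0 := congr_hom (augmentation_d J' h'.d_eq_zero) j
      have h₂ : (H.hom i j ≫ a'.f j) ≫ (J'.d 0 1).f j = 0 := by
        rw [Category.assoc, h₁, comp_zero]
      exact h₂
  choose s hs using lift
  let t (i j : ℤ) : (J.X 0).X i ⟶ (J'.X 0).X j := (s i j).f 0
  have ht (i j : ℤ) : a.f i ≫ t i j = H.hom i j ≫ a'.f j := hs i j
  -- Since each `s i j` commutes with the vertical differentials, the horizontal expression `d s + s
  -- d` is a morphism of double complexes.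
  let N : HomologicalComplex₂.flip J ⟶ HomologicalComplex₂.flip J' :=
    Homotopy.nullHomotopicMap' (fun i j _ => s i j)
  have hN (j : ℤ) : ((unflip N).f 0).f j =
      (J.X 0).d j (j + 1) ≫ t (j + 1) j + t j (j - 1) ≫ (J'.X 0).d (j - 1) j := by
    have hN : N.f j = (HomologicalComplex₂.flip J).d j (j + 1) ≫ s (j + 1) j +
        s j (j - 1) ≫ (HomologicalComplex₂.flip J').d (j - 1) j :=
      Homotopy.nullHomotopicMap'_f (show (ComplexShape.up ℤ).Rel (j - 1) j by simp)
        (show (ComplexShape.up ℤ).Rel j (j + 1) by simp) _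
    exact congr_hom hN 0
  have hχ : a ≫ (χ - unflip N).f 0 = 0 := by
    rw [sub_f_apply, Preadditive.comp_sub, sub_eq_zero, ← augmentation_naturality _ _ h'.d_eq_zero]
    ext j
    have hj := H.comm j
    rw [dNext_eq _ (show (ComplexShape.up ℤ).Rel j (j + 1) by simp),
      prevD_eq _ (show (ComplexShape.up ℤ).Rel (j - 1) j by simp), zero_f, add_zero] at hj
    rw [comp_f, comp_f, hN, hj, Preadditive.add_comp, Preadditive.comp_add, Category.assoc,
      Category.assoc, ← ht, a.comm_assoc, reassoc_of% (ht j (j - 1)), a'.comm]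
  -- What remains of `χ` vanishes on the augmentation, so it is null-homotopic in the vertical
  -- direction.
  obtain ⟨K⟩ := nonempty_homotopy_zero_of_isHomExact h.zero_of_neg
    (fun i _ => h.isHomExact (h'.injective i)) (χ - unflip N) hχ
  obtain ⟨T, b, c, hbc⟩ := exists_factorization_of_homotopy_zero
    (Homotopy.nullHomotopy' (fun i j (_ : (ComplexShape.up ℤ).Rel j i) => s i j))
  obtain ⟨T', b', c', hbc'⟩ := exists_factorization_of_homotopy_zero K
  refine ⟨_, isSplitAcyclic_biprod ⟨T, ⟨Iso.refl _⟩⟩ ⟨T', ⟨Iso.refl _⟩⟩,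
    biprod.lift (unflip (K := J) (L := HomologicalComplex₂.flip (splitAcyclicComplex T)) b) b',
    biprod.desc (unflip (K := HomologicalComplex₂.flip (splitAcyclicComplex T)) (L := J') c) c', ?_⟩
  have : unflip N = unflip (K := J) (L := HomologicalComplex₂.flip (splitAcyclicComplex T)) b ≫
      unflip (K := HomologicalComplex₂.flip (splitAcyclicComplex T)) (L := J') c := by
    change unflip (Homotopy.nullHomotopicMap' _) = _
    rw [hbc]
    rfl
  rw [biprod.lift_desc, ← hbc', ← this, add_sub_cancel]

instance : (ceHomotopyHZero A).Full where
  map_surjective {X Y} f := by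
    obtain ⟨g, hg⟩ := (HomotopyCategory.quotient A (ComplexShape.up ℤ)).map_surjective
      (X := (columnwiseHZero A).obj X.obj.as) (Y := (columnwiseHZero A).obj Y.obj.as) f.hom
    obtain ⟨φ, hφ⟩ := exists_map_columnwiseHZero_eq X.property Y.property g
    refine ⟨ObjectProperty.homMk ((CategoryTheory.Quotient.functor _).map φ), ?_⟩
    ext
    rw [← hg, ← hφ]
    rfl

instance : (ceHomotopyHZero A).Faithful where
  map_injective {X Y} f g hfg := by
    obtain ⟨φ, hφ⟩ := (CategoryTheory.Quotient.functor (factorsRel (isSplitAcyclic A))).map_surjective f.hom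
    obtain ⟨ψ, hψ⟩ := (CategoryTheory.Quotient.functor (factorsRel (isSplitAcyclic A))).map_surjective g.hom
    ext
    rw [← hφ, ← hψ]
    apply CategoryTheory.Quotient.sound
    have h : (columnwiseHZeroQuotient A).map φ = (columnwiseHZeroQuotient A).map ψ := by
      have := congr_arg InducedCategory.Hom.hom hfg
      change (doubleHomotopyHZero A).map f.hom = (doubleHomotopyHZero A).map g.hom at this
      rw [← hφ, ← hψ] at this
      exact this
    rw [← sub_eq_zero, ← Functor.map_sub] at h
    obtain ⟨H⟩ := (HomotopyCategory.quotient_map_eq_zero_iff _).1 h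
    exact exists_factorization_of_homotopy X.property Y.property _ H

end Functor

end CERes

/-! ### Existence of Cartan–Eilenberg resolutions -/

namespace CERes

section Existence

variable {A : Type u} [Category.{v} A] [Abelian A]

open HomologicalComplex
open scoped ZeroObject

theorem IsPureMono.isPureShortExact_cokernel {X Y : CochainComplex A ℤ} {f : X ⟶ Y}
    (hf : IsPureMono f) :
    IsPureShortExact (ShortComplex.mk f (cokernel.π f) (cokernel.condition f)) := by
  have := hf.mono
  exact CERes.isPureShortExact_cokernel f hf.mono_homologyMap

theorem isStrictlyGE_of_epi {X Y : CochainComplex A ℤ} (f : X ⟶ Y) [Epi f]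
    (hX : X.IsStrictlyGE 0) : Y.IsStrictlyGE 0 := by
  rw [CochainComplex.isStrictlyGE_iff] at hX ⊢
  exact fun i hi => (hX i hi).of_epi (f.f i)

/-- The construction iterates because the cokernel of each embedding again lives in degrees `≥ 0`.
-/
theorem exists_relativelyInjective_resolution [EnoughInjectives A] (X : CochainComplex A ℤ)
    (hX : X.IsStrictlyGE 0) :
    ∃ (Y I : ℕ → CochainComplex A ℤ) (f : ∀ n, Y n ⟶ I n) (p : ∀ n, I n ⟶ Y (n + 1))
      (w : ∀ n, f n ≫ p n = 0), Y 0 = X ∧ ∀ n, IsPureShortExact (ShortComplex.mk _ _ (w n)) ∧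
        IsRelativelyInjective (I n) ∧ (I n).IsStrictlyGE 0 := by
  choose I f hf hI hI' _ using exists_pureMono_relativelyInjective (A := A)
  let Y : ℕ → { X : CochainComplex A ℤ // X.IsStrictlyGE 0 } := fun n =>
    Nat.rec ⟨X, hX⟩ (fun _ Y => ⟨cokernel (f Y.1 Y.2),
      isStrictlyGE_of_epi (cokernel.π (f Y.1 Y.2)) (hI' Y.1 Y.2)⟩) n
  exact ⟨fun n => (Y n).1, fun n => I (Y n).1 (Y n).2, fun n => f (Y n).1 (Y n).2,
    fun n => cokernel.π (f (Y n).1 (Y n).2), fun n => cokernel.condition _, rfl,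
    fun n => ⟨(hf _ _).isPureShortExact_cokernel, hI _ _, hI' _ _⟩⟩

theorem exact_comp_comp {X Y Z W T : CochainComplex A ℤ} {p : X ⟶ Y} {f : Y ⟶ Z} {q : Z ⟶ W}
    {g : W ⟶ T} [Epi p] [Mono g] {w : f ≫ q = 0} (h : (ShortComplex.mk f q w).Exact) :
    (ShortComplex.mk (p ≫ f) (q ≫ g) (by simp [reassoc_of% w])).Exact := by
  have h₁ : (ShortComplex.mk (p ≫ f) q (by simp [w])).Exact :=
    (ShortComplex.exact_iff_of_epi_of_isIso_of_mono
      (S₁ := ShortComplex.mk (p ≫ f) q (by simp [w])) (S₂ := ShortComplex.mk f q w)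
      { τ₁ := p, τ₂ := 𝟙 _, τ₃ := 𝟙 _ }).2 h
  exact (ShortComplex.exact_iff_of_epi_of_isIso_of_mono
    (S₁ := ShortComplex.mk (p ≫ f) q (by simp [w]))
    (S₂ := ShortComplex.mk (p ≫ f) (q ≫ g) (by simp [reassoc_of% w]))
    { τ₁ := 𝟙 _, τ₂ := 𝟙 _, τ₃ := g }).1 h₁

/-- The predicate `Q` transports all properties of the short sequences to the entries of `J`, so
that the case distinction defining `J` need not be unfolded later. -/
theorem exists_splicing {E : Type u} [Category.{v} E] [Preadditive E] [HasZeroObject E]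
    (Q : ShortComplex E → Prop) (Y I : ℕ → E) (f : ∀ n, Y n ⟶ I n) (p : ∀ n, I n ⟶ Y (n + 1))
    (w : ∀ n, f n ≫ p n = 0) (h : ∀ n, Q (ShortComplex.mk _ _ (w n))) :
    ∃ (J : CochainComplex E ℤ) (f : ∀ n : ℕ, Y n ⟶ J.X n) (p : ∀ n : ℕ, J.X n ⟶ Y (n + 1))
      (w : ∀ n, f n ≫ p n = 0), (∀ n, Q (ShortComplex.mk _ _ (w n))) ∧
        (∀ n : ℕ, J.d n (n + 1 : ℕ) = p n ≫ f (n + 1)) ∧ ∀ k < 0, IsZero (J.X k) := by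
  let X : ℤ → E := fun k => match k with
    | .ofNat n => I n
    | .negSucc _ => 0
  let d : ∀ k, X k ⟶ X (k + 1) := fun k => match k with
    | .ofNat n => p n ≫ f (n + 1)
    | .negSucc _ => 0
  have hd (k : ℤ) : d k ≫ d (k + 1) = 0 := match k with
    | .ofNat n => by
      have : (p n ≫ f (n + 1)) ≫ p (n + 1) ≫ f (n + 1 + 1) = 0 := by simp [reassoc_of% (w (n + 1))]
      exact this
    | .negSucc _ => zero_comp
  refine ⟨CochainComplex.of X d hd, f, p, w, h, fun n => ?_, fun k hk => ?_⟩
  · have := CochainComplex.of_d X d (n : ℤ)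
    exact this
  · match k, hk with
    | .negSucc _, _ => exact isZero_zero E

theorem isPureMono_of_isZero {X Y : CochainComplex A ℤ} (f : X ⟶ Y) (hX : IsZero X) :
    IsPureMono f := by
  have : Mono f := ⟨fun _ _ _ => hX.eq_of_tgt _ _⟩
  exact isPureMono_of_mono f fun i => ⟨fun _ _ _ =>
    ((homologyFunctor A (ComplexShape.up ℤ) i).map_isZero hX).eq_of_tgt _ _⟩

theorem isPure_of_isZero {X Y : CochainComplex A ℤ} (f : X ⟶ Y) (hX : IsZero X) :
    IsPure f := by
  refine ⟨X, 𝟙 X, f, ⟨X, 𝟙 X, hX.eq_of_src _ _, ?_⟩, isPureMono_of_isZero f hX, Category.id_comp f⟩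
  exact ⟨{ exact := ShortComplex.exact_of_isZero_X₂ _ hX
           mono_f := (inferInstance : Mono (𝟙 X))
           epi_g := (inferInstance : Epi (𝟙 X)) }, fun i j _ =>
    ((homologyFunctor A (ComplexShape.up ℤ) i).map_isZero hX).eq_of_src _ _⟩

theorem exists_isCartanEilenbergResolution [EnoughInjectives A] (X : CochainComplex A ℤ)
    (hX : X.IsStrictlyGE 0) : ∃ (J : DoubleComplex A)
      (ε : (HomologicalComplex.single (CochainComplex A ℤ) (ComplexShape.up ℤ) 0).obj X ⟶ J),
        isFirstQuadrant A J ∧ IsCartanEilenbergResolution X J ε := by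
  obtain ⟨Y, I, f, p, w, rfl, h⟩ := exists_relativelyInjective_resolution X hX
  obtain ⟨J, f, p, w, h, hd, hJ⟩ := exists_splicing (fun S => IsPureShortExact S ∧
    IsRelativelyInjective S.X₂ ∧ S.X₂.IsStrictlyGE 0) Y I f p w h
  have hf (n : ℕ) : IsPureMono (f n) := ⟨_, _, _, (h n).1⟩
  have hp (n : ℕ) : IsPureEpi (p n) := ⟨_, _, _, (h n).1⟩
  have hf' (n : ℕ) : Mono (f n) := (hf n).mono
  have hp' (n : ℕ) : Epi (p n) := (hp n).epi
  have hfp (n : ℕ) : (ShortComplex.mk _ _ (w n)).Exact := (h n).1.choose.exact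
  let f₀ : Y 0 ⟶ J.X 0 := f 0
  have hd₀ : J.d 0 1 = p 0 ≫ f 1 := hd 0
  have w₀ : f₀ ≫ J.d 0 1 = 0 := by
    rw [hd₀]
    exact (reassoc_of% (w 0)) _ |>.trans zero_comp
  let ε : (HomologicalComplex.single (CochainComplex A ℤ) (ComplexShape.up ℤ) 0).obj (Y 0) ⟶ J :=
    mkHomFromSingle f₀ (by
      rintro k hk
      obtain rfl : 0 + 1 = k := hk
      exact w₀)
  have hε : ε.f 0 = (singleObjXSelf (ComplexShape.up ℤ) 0 (Y 0)).hom ≫ f₀ :=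
    mkHomFromSingle_f _ _
  have hε₀ : ∀ k : ℤ, k ≠ 0 → IsZero (((HomologicalComplex.single (CochainComplex A ℤ)
      (ComplexShape.up ℤ) 0).obj (Y 0)).X k) := fun k hk => isZero_single_obj_X _ _ _ _ hk
  refine ⟨J, ε, fun i j hij => ?_, ⟨hJ, fun k => ?_, fun k => ?_, ⟨fun k => ?_⟩, fun k => ?_⟩⟩
  · by_cases hi : i < 0
    · exact (eval A (ComplexShape.up ℤ) j).map_isZero (hJ i hi)
    · obtain ⟨n, rfl⟩ := Int.eq_ofNat_of_zero_le (not_lt.1 hi)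
      have : CochainComplex.IsStrictlyGE (J.X n) 0 := (h n).2.2
      exact CochainComplex.isZero_of_isStrictlyGE (J.X n) 0 j (by omega)
  · by_cases hk : k < 0
    · exact fun _ _ _ _ _ => ⟨0, (hJ k hk).eq_of_tgt _ _⟩
    · obtain ⟨n, rfl⟩ := Int.eq_ofNat_of_zero_le (not_lt.1 hk)
      exact (h n).2.1
  · by_cases hk : k < 0
    · exact isPure_of_isZero _ (hJ k hk)
    · obtain ⟨n, rfl⟩ := Int.eq_ofNat_of_zero_le (not_lt.1 hk)
      exact ⟨_, p n, f (n + 1), hp n, hf (n + 1), (hd n).symm⟩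
  · obtain hk | rfl | hk := lt_trichotomy k 0
    · rw [quasiIsoAt_iff_exactAt _ _ (exactAt_single_obj _ _ _ _ hk.ne)]
      exact ShortComplex.exact_of_isZero_X₂ _ (hJ k hk)
    · rw [quasiIsoAt_iff' ε (-1) 0 1 (by simp) (by simp), ShortComplex.quasiIso_iff_of_zeros _ rfl
        rfl ((hJ (-1) (by simp)).eq_of_src _ _)]
      have hε' : Mono (ε.f 0) := by
        rw [hε]
        have : Mono f₀ := hf' 0
        infer_instance
      refine ⟨?_, hε'⟩
      -- `J.d 0 1` is `p 0` followed by a monomorphism, so it has the same kernel as `p 0`.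
      have h₁ : (ShortComplex.mk _ _ w₀).Exact :=
        (ShortComplex.exact_iff_of_epi_of_isIso_of_mono
          (S₁ := ShortComplex.mk f₀ (p 0) (w 0)) (S₂ := ShortComplex.mk f₀ (J.d 0 1) w₀)
          { τ₁ := 𝟙 _, τ₂ := 𝟙 _, τ₃ := f 1, comm₂₃ := (Category.id_comp _).trans hd₀ }).1 (hfp 0)
      exact (ShortComplex.exact_iff_of_epi_of_isIso_of_mono
        (S₁ := ShortComplex.mk (ε.f 0) (J.d 0 1) (by simp))
        (S₂ := ShortComplex.mk f₀ (J.d 0 1) w₀)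
        { τ₁ := (singleObjXSelf (ComplexShape.up ℤ) 0 (Y 0)).hom, τ₂ := 𝟙 _, τ₃ := 𝟙 _ }).2 h₁
    · rw [quasiIsoAt_iff_exactAt _ _ (exactAt_single_obj _ _ _ _ hk.ne')]
      obtain ⟨n, rfl⟩ : ∃ n : ℕ, k = (n + 1 : ℕ) := ⟨(k - 1).toNat, by omega⟩
      rw [J.exactAt_iff' (n : ℤ) _ (n + 1 + 1 : ℕ) (by simp) (by simp)]
      have h₁ := exact_comp_comp (p := p n) (g := f (n + 1 + 1)) (hfp (n + 1))
      simp only [← hd] at h₁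
      exact h₁
  · by_cases hk : k = 0
    · subst hk
      rw [hε]
      have h₁ : Mono f₀ := hf' 0
      refine isPureMono_of_mono _ fun i => ?_
      have h₂ : Mono (homologyMap f₀ i) := (hf 0).mono_homologyMap i
      rw [homologyMap_comp]
      infer_instance
    · exact isPureMono_of_isZero _ (hε₀ k hk)

/-- Both sides are kernels of `J.d 0 1`, via the augmentation and via `ε.f 0`. -/
theorem IsCartanEilenbergResolution.nonempty_iso {X : CochainComplex A ℤ} {J : DoubleComplex A}
    {ε : (HomologicalComplex.single (CochainComplex A ℤ) (ComplexShape.up ℤ) 0).obj X ⟶ J}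
    (h : IsCartanEilenbergResolution X J ε) : Nonempty ((columnwiseHZero A).obj J ≅ X) := by
  have := (h.pureMono 0).mono
  let e : (columnwiseHZero A).obj J ≅ ((HomologicalComplex.single (CochainComplex A ℤ)
      (ComplexShape.up ℤ) 0).obj X).X 0 :=
    IsLimit.conePointUniqueUpToIso (augmentation_exact J h.d_eq_zero).fIsKernel
      h.ε_exact.fIsKernel
  exact ⟨e ≪≫ singleObjXSelf _ _ _⟩

instance [EnoughInjectives A] : (ceHomotopyHZero A).EssSurj where
  mem_essImage Y := by
    obtain ⟨J, ε, hJ, h⟩ := exists_isCartanEilenbergResolution Y.obj.as Y.property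
    obtain ⟨e⟩ := h.nonempty_iso
    exact ⟨⟨⟨J⟩, hJ, _, ε, h⟩, ⟨ObjectProperty.isoMk _
      ((HomotopyCategory.quotient A (ComplexShape.up ℤ)).mapIso e)⟩⟩

instance [EnoughInjectives A] : (ceHomotopyHZero A).IsEquivalence where

end Existence

end CERes

theorem proposition2p8 (A : Type u) [Category.{v} A] [Abelian A] [EnoughInjectives A] :
    ∃ F : CERes.CEHomotopyCategory A ⥤ CERes.HomotopyGEZero A,
      CERes.ceQuotient A ⋙ F = CERes.ceHZero A ⋙ CERes.complexQuotient A ∧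
        F.IsEquivalence :=
  ⟨CERes.ceHomotopyHZero A, CERes.ceQuotient_comp_ceHomotopyHZero A, inferInstance⟩
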